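/- Let $F=F(X_r)$ be the free group with basis $X_r=\{x_1,\dots,x_r\}$, let $F^{(0)}=F$ and $F^{(k+1)}=[F^{(k)},F^{(k)}]$, and let $S_{r,k}=F/F^{(k)}$ be the free solvable group of rank $r$ and class $k$. For $y\in F$ and $k\ge 0$ let $\mathrm{Sch}_k(y)$ be the Schreier graph of the cyclic subgroup $H=\langle y\rangle$ of $S_{r,k}$: its vertices are the cosets $Hg$, $g\in S_{r,k}$, its root is $H$, and its edges are $Hg\xrightarrow{a}Hga$ for $g\in S_{r,k}$ and $a\in X_r^{\pm}$; the positive edges are those with label $a\in X_r$, and the edge inverse to $Hg\xrightarrow{a}Hga$ is $Hga\xrightarrow{a^{-1}}Hg$. A word $w\in F$ labels a unique path $p_w$ starting at the root, and its flow $\pi_w$ is the function that assigns to each positive edge $e$ the number of times that $p_w$ traverses $e$ minus the number of times that it traverses the inverse edge $e^{-1}$. Let $r\ge 0$, $d\ge 1$ and $x,y\in F(X_r)$. Then $x$ and $y$ represent conjugate elements of $S_{r,d}$ if and only if there is $z\in F(X_r)$ such that $\pi_{zxz^{-1}}=\pi_y$ on $\mathrm{Sch}_{d-1}(y)$. Moreover,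 $z$ can be viewed as an element of $S_{r,d-1}$: if $z,z'\in F(X_r)$ have the same image in $S_{r,d-1}$, then $\pi_{zxz^{-1}}=\pi_y$ on $\mathrm{Sch}_{d-1}(y)$ if and only if $\pi_{z'xz'^{-1}}=\pi_y$ on $\mathrm{Sch}_{d-1}(y)$. -/

import Mathlib

/-- An edge `origin → terminus` labelled by a letter of `X^±`; as in Mathlib's `FreeGroup`, the
letter `(x, true)` stands for `x` and `(x, false)` for `x⁻¹`. -/
@[ext]
structure XEdge (X V : Type*) where
  origin : V
  terminus : V
  label : X × Bool

/-- The inverse edge. -/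
def XEdge.inv {X V : Type*} (e : XEdge X V) : XEdge X V :=
  ⟨e.terminus, e.origin, (e.label.1, !e.label.2)⟩

/-- A rooted digraph with vertex set `V` and edges labelled by letters of `X^±`. -/
structure XDigraph (X V : Type*) where
  root : V
  edges : Set (XEdge X V)

namespace XDigraph

variable {X V : Type*}

/-- For every vertex and letter there is at most one edge with that origin and label. -/
def IsFolded (Γ : XDigraph X V) : Prop :=
  ∀ e ∈ Γ.edges, ∀ e' ∈ Γ.edges, e.origin = e'.origin → e.label = e'.label → e = e'

/-- For every vertex and letter there is an edge with that origin and label. -/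
def IsComplete (Γ : XDigraph X V) : Prop :=
  ∀ (v : V) (a : X × Bool), ∃ e ∈ Γ.edges, e.origin = v ∧ e.label = a

/-- With every edge the graph contains the inverse edge. -/
def IsInverse (Γ : XDigraph X V) : Prop :=
  ∀ e ∈ Γ.edges, e.inv ∈ Γ.edges

/-- `Γ.IsPathFrom v p`: the list of edges `p` is a path in `Γ` with origin `v`. -/
def IsPathFrom (Γ : XDigraph X V) : V → List (XEdge X V) → Prop
  | _, [] => True
  | v, e :: p => e ∈ Γ.edges ∧ e.origin = v ∧ Γ.IsPathFrom e.terminus p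

/-- `p` is a trace of the word `w` in `Γ`: a path with origin the root and label `w`. -/
def IsTrace (Γ : XDigraph X V) (w : List (X × Bool)) (p : List (XEdge X V)) : Prop :=
  Γ.IsPathFrom Γ.root p ∧ p.map XEdge.label = w

/-- The positive edges: those labelled by a letter of `X`. -/
def PosEdge (Γ : XDigraph X V) : Type _ :=
  {e : XEdge X V // e ∈ Γ.edges ∧ e.label.2 = true}

open Classical in
/-- The number of times `p` traverses the edge `e` minus the number of times it traverses the
inverse edge. -/
noncomputable def pathFlow (Γ : XDigraph X V) (p : List (XEdge X V)) (e : Γ.PosEdge) : ℤ :=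
  (p.count e.1 : ℤ) - (p.count e.1.inv : ℤ)

open Classical in
/-- The flow `π_w` of `w` on `Γ`, i.e. the flow of the trace of (the reduced word) `w`. The value
`0` for words without a trace is never used on complete graphs. -/
noncomputable def wordFlow [DecidableEq X] (Γ : XDigraph X V) (w : FreeGroup X) :
    Γ.PosEdge → ℤ :=
  if h : ∃ p, Γ.IsTrace w.toWord p then Γ.pathFlow h.choose else 0

theorem exists_path {Γ : XDigraph X V} (hΓ : Γ.IsComplete) (w : List (X × Bool)) :
    ∀ v : V, ∃ p, Γ.IsPathFrom v p ∧ p.map XEdge.label = w := by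
  induction w with
  | nil => exact fun v => ⟨[], trivial, rfl⟩
  | cons a w ih =>
    intro v
    obtain ⟨e, he, hv, ha⟩ := hΓ v a
    obtain ⟨p, hp, hw⟩ := ih e.terminus
    exact ⟨e :: p, ⟨he, hv, hp⟩, by simp [ha, hw]⟩

theorem path_unique {Γ : XDigraph X V} (hΓ : Γ.IsFolded) (p : List (XEdge X V)) :
    ∀ (q : List (XEdge X V)) (v : V), Γ.IsPathFrom v p → Γ.IsPathFrom v q →
      p.map XEdge.label = q.map XEdge.label → p = q := by
  induction p with
  | nil =>
    intro q v _ _ h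
    cases q with
    | nil => rfl
    | cons e q => simp at h
  | cons e p ih =>
    intro q v hp hq h
    cases q with
    | nil => simp at h
    | cons e' q =>
      obtain ⟨he, hv, hp⟩ := hp
      obtain ⟨he', hv', hq⟩ := hq
      simp only [List.map_cons, List.cons.injEq] at h
      have hee : e = e' := hΓ e he e' he' (hv.trans hv'.symm) h.1
      subst hee
      rw [ih q _ hp hq h.2]

/-- On a folded graph `wordFlow` is computed by any trace. -/
theorem wordFlow_eq [DecidableEq X] {Γ : XDigraph X V} (hΓ : Γ.IsFolded) {w : FreeGroup X}
    {p : List (XEdge X V)} (hp : Γ.IsTrace w.toWord p) : Γ.wordFlow w = Γ.pathFlow p := by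
  have h : ∃ p, Γ.IsTrace w.toWord p := ⟨p, hp⟩
  rw [wordFlow, dif_pos h,
    path_unique hΓ _ p Γ.root h.choose_spec.1 hp.1 (h.choose_spec.2.trans hp.2.symm)]

end XDigraph

/-- The set of right cosets `Hg`. -/
abbrev RightCosets {G : Type*} [Group G] (H : Subgroup G) : Type _ :=
  Quotient (QuotientGroup.rightRel H)

/-- The right coset `Hg`. -/
def rightCosetMk {G : Type*} [Group G] (H : Subgroup G) (g : G) : RightCosets H :=
  Quotient.mk (QuotientGroup.rightRel H) g

theorem rightCosetMk_eq_iff {G : Type*} [Group G] (H : Subgroup G) (g g' : G) :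
    rightCosetMk H g = rightCosetMk H g' ↔ g' * g⁻¹ ∈ H := by
  rw [rightCosetMk, rightCosetMk, Quotient.eq, QuotientGroup.rightRel_apply]

/-- The Schreier graph of a subgroup `H` of `G = F(X)/N`: its vertices are the cosets `Hg`, its
edges are `Hg → Hga` labelled by `a`, for `g ∈ G` and `a ∈ X^±`, and its root is `H`. -/
def schreierGraph {X : Type*} (N : Subgroup (FreeGroup X)) [N.Normal]
    (H : Subgroup (FreeGroup X ⧸ N)) : XDigraph X (RightCosets H) where
  root := rightCosetMk H 1
  edges := {e | ∃ (g : FreeGroup X ⧸ N) (a : X × Bool),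
    e = ⟨rightCosetMk H g, rightCosetMk H (g * QuotientGroup.mk (FreeGroup.mk [a])), a⟩}

theorem schreierGraph_isFolded {X : Type*} (N : Subgroup (FreeGroup X)) [N.Normal]
    (H : Subgroup (FreeGroup X ⧸ N)) : (schreierGraph N H).IsFolded := by
  rintro _ ⟨g, a, rfl⟩ _ ⟨g', a', rfl⟩ h h'
  simp only at h h'
  subst h'
  rw [XEdge.mk.injEq]
  refine ⟨h, ?_, rfl⟩
  rw [rightCosetMk_eq_iff] at h ⊢
  simpa [mul_assoc] using h

theorem schreierGraph_isComplete {X : Type*} (N : Subgroup (FreeGroup X)) [N.Normal]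
    (H : Subgroup (FreeGroup X ⧸ N)) : (schreierGraph N H).IsComplete := by
  intro v a
  induction v using Quotient.inductionOn with
  | h g => exact ⟨_, ⟨g, a, rfl⟩, rfl, rfl⟩

theorem schreierGraph_isInverse {X : Type*} (N : Subgroup (FreeGroup X)) [N.Normal]
    (H : Subgroup (FreeGroup X ⧸ N)) : (schreierGraph N H).IsInverse := by
  rintro _ ⟨g, a, rfl⟩
  refine ⟨g * QuotientGroup.mk (FreeGroup.mk [a]), (a.1, !a.2), ?_⟩
  have h : (FreeGroup.mk [(a.1, !a.2)] : FreeGroup X) = (FreeGroup.mk [a])⁻¹ := by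
    simp [FreeGroup.inv_mk, FreeGroup.invRev]
  rw [h, QuotientGroup.mk_inv, mul_inv_cancel_right]
  rfl

/-- The free solvable group `S_{r,d} = F/F^{(d)}` of rank `r` and class `d`. -/
abbrev FreeSolvable (r d : ℕ) : Type :=
  FreeGroup (Fin r) ⧸ derivedSeries (FreeGroup (Fin r)) d

/-- The canonical epimorphism from the free group onto `S_{r,d}`. -/
def toFreeSolvable (r d : ℕ) : FreeGroup (Fin r) →* FreeSolvable r d :=
  QuotientGroup.mk' (derivedSeries (FreeGroup (Fin r)) d)

/-- `Sch_d(y)`, the Schreier graph of the cyclic subgroup `⟨y⟩` of `S_{r,d}`. -/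
def schreierOf (r d : ℕ) (y : FreeGroup (Fin r)) :
    XDigraph (Fin r) (RightCosets (Subgroup.zpowers (toFreeSolvable r d y))) :=
  schreierGraph (derivedSeries (FreeGroup (Fin r)) d) (Subgroup.zpowers (toFreeSolvable r d y))

/-! Put `N = F^(d-1)`, so that `F^(d) = [N,N]`, and let `K = ⟨y⟩N` be the preimage in `F` of the
cyclic subgroup of `F/N` generated by `y`. Loops at the root of the Schreier graph are the words in
`K`, and their flows see exactly the abelianization of `K`: `π_w = π_y` if and only if `w y⁻¹ ∈
[K,K]` (`wordFlow_eq_iff_mem_commutator`).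

It remains to compare `[K,K]` with `[N,N]`. Modulo `[N,N]` the group `K` is generated by `y` and the
commutative normal image of `N`, so each element of `[K,K]` becomes a single commutator `n y n⁻¹
y⁻¹` with `n ∈ N` (`exists_conj_of_mem_commutator_comap_zpowers`). Hence `z x z⁻¹ y⁻¹ ∈ [K,K]` gives
`z x z⁻¹ ≡ n y n⁻¹` modulo `[N,N]`, which is conjugacy in `F/[N,N]`. The converse uses only `[N,N] ≤
[K,K]`. -/

section Commutators

/-! ### Commutators in an extension of a cyclic group by a commutative one -/

/-- If `G` is generated by an element `y` and a commutative normal subgroup `A`, then every element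
of the commutator subgroup has the form `n y n⁻¹ y⁻¹` with `n ∈ A`. -/
theorem exists_eq_conj_of_mem_commutator {G : Type*} [Group G] (A : Subgroup G) [A.Normal]
    (hA : ∀ a ∈ A, ∀ b ∈ A, a * b = b * a) (y : G)
    (hG : ∀ g : G, ∃ i : ℤ, ∃ a ∈ A, g = y ^ i * a) {c : G} (hc : c ∈ commutator G) :
    ∃ n ∈ A, c = n * y * n⁻¹ * y⁻¹ := by
  have hconj : ∀ g : G, ∀ a ∈ A, g * a * g⁻¹ ∈ A := fun g a ha =>
    Subgroup.Normal.conj_mem ‹_› a ha g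
  -- Each value is the product of `n` and `y n⁻¹ y⁻¹`, both in the commutative normal subgroup `A`;
  -- hence multiplicativity.
  let f : A →* G :=
    { toFun := fun n => n * y * (n : G)⁻¹ * y⁻¹
      map_one' := by simp
      map_mul' := by
        rintro ⟨m, hm⟩ ⟨n, hn⟩
        have h := hA m hm (n * (y * n⁻¹ * y⁻¹)) (A.mul_mem hn (hconj y _ (A.inv_mem hn)))
        calc m * n * y * (m * n)⁻¹ * y⁻¹
            = m * n * ((y * n⁻¹ * y⁻¹) * (y * m⁻¹ * y⁻¹)) := by group
          _ = m * (n * (y * n⁻¹ * y⁻¹)) * (y * m⁻¹ * y⁻¹) := by group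
          _ = n * (y * n⁻¹ * y⁻¹) * m * (y * m⁻¹ * y⁻¹) := by rw [h]
          _ = (n * (y * n⁻¹ * y⁻¹)) * (m * (y * m⁻¹ * y⁻¹)) := by group
          _ = (m * (y * m⁻¹ * y⁻¹)) * (n * (y * n⁻¹ * y⁻¹)) :=
            hA _ (A.mul_mem hn (hconj y _ (A.inv_mem hn))) _
              (A.mul_mem hm (hconj y _ (A.inv_mem hm)))
          _ = m * y * m⁻¹ * y⁻¹ * (n * y * n⁻¹ * y⁻¹) := by group }
  have hf : ∀ n ∈ A, n * y * n⁻¹ * y⁻¹ ∈ f.range := fun n hn => ⟨⟨n, hn⟩, rfl⟩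
  -- Conjugation by `a ∈ A` fixes the values of `f`, and conjugation by `y ^ i` moves the value at
  -- `n` to the value at `y ^ i n y ^ (-i)`.
  have hnormal : f.range.Normal := by
    constructor
    rintro _ ⟨⟨n, hn⟩, rfl⟩ g
    obtain ⟨i, a, ha, rfl⟩ := hG g
    have hm : y ^ i * n * (y ^ i)⁻¹ ∈ A := hconj _ _ hn
    refine ⟨⟨_, hm⟩, ?_⟩
    have h := hA a ha (n * (y * n⁻¹ * y⁻¹)) (A.mul_mem hn (hconj y _ (A.inv_mem hn)))
    change y ^ i * n * (y ^ i)⁻¹ * y * (y ^ i * n * (y ^ i)⁻¹)⁻¹ * y⁻¹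
      = y ^ i * a * (n * y * n⁻¹ * y⁻¹) * (y ^ i * a)⁻¹
    calc y ^ i * n * (y ^ i)⁻¹ * y * (y ^ i * n * (y ^ i)⁻¹)⁻¹ * y⁻¹
        = y ^ i * (n * (y * n⁻¹ * y⁻¹)) * (y ^ i)⁻¹ := by group
      _ = y ^ i * (n * (y * n⁻¹ * y⁻¹) * a) * a⁻¹ * (y ^ i)⁻¹ := by group
      _ = y ^ i * (a * (n * (y * n⁻¹ * y⁻¹))) * a⁻¹ * (y ^ i)⁻¹ := by rw [h]
      _ = y ^ i * a * (n * y * n⁻¹ * y⁻¹) * (y ^ i * a)⁻¹ := by group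
  -- Killing the range makes `y` commute with `A`, so the quotient is commutative and the range
  -- contains the commutator subgroup.
  have hya : ∀ a ∈ A, Commute (y : G ⧸ f.range) (a : G ⧸ f.range) := by
    intro a ha
    change ((y * a : G) : G ⧸ f.range) = ((a * y : G) : G ⧸ f.range)
    rw [eq_comm, ← mul_inv_eq_one, ← QuotientGroup.mk_inv, ← QuotientGroup.mk_mul,
      QuotientGroup.eq_one_iff]
    convert hf a ha using 1
    group
  have hcomm : ∀ p q : G ⧸ f.range, p * q = q * p := by
    intro p q
    induction p using QuotientGroup.induction_on with | _ g => ?_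
    induction q using QuotientGroup.induction_on with | _ h => ?_
    obtain ⟨i, a, ha, rfl⟩ := hG g
    obtain ⟨j, b, hb, rfl⟩ := hG h
    have hab : Commute (a : G ⧸ f.range) (b : G ⧸ f.range) := by
      change ((a * b : G) : G ⧸ f.range) = ((b * a : G) : G ⧸ f.range)
      rw [hA a ha b hb]
    simp only [QuotientGroup.mk_mul, QuotientGroup.mk_zpow]
    exact ((Commute.refl _).zpow_zpow i j |>.mul_right ((hya b hb).zpow_left i)).mul_left
      (((hya a ha).symm.zpow_right j).mul_right hab)
  have hle : commutator G ≤ f.range := by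
    rw [commutator_def, Subgroup.commutator_le]
    intro g _ h _
    rw [← QuotientGroup.eq_one_iff, commutatorElement_def]
    simp only [QuotientGroup.mk_mul, QuotientGroup.mk_inv]
    rw [hcomm (g : G ⧸ f.range) h]
    group
  obtain ⟨⟨n, hn⟩, rfl⟩ := hle hc
  exact ⟨n, hn, rfl⟩

/-- For `N` normal in `G` and `K = ⟨y⟩N`, elements of `[K, K]` are congruent modulo `[N, N]` to
elements `n y n⁻¹ y⁻¹` with `n ∈ N`. -/
theorem exists_conj_of_mem_commutator_comap_zpowers {G : Type*} [Group G] (N : Subgroup G)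
    [N.Normal] (y : G) {c : G}
    (hc : c ∈ ⁅(Subgroup.zpowers (QuotientGroup.mk' N y)).comap (QuotientGroup.mk' N),
      (Subgroup.zpowers (QuotientGroup.mk' N y)).comap (QuotientGroup.mk' N)⁆) :
    ∃ n ∈ N, QuotientGroup.mk' ⁅N, N⁆ c = QuotientGroup.mk' ⁅N, N⁆ (n * y * n⁻¹ * y⁻¹) := by
  set K := (Subgroup.zpowers (QuotientGroup.mk' N y)).comap (QuotientGroup.mk' N) with hK
  set π := QuotientGroup.mk' ⁅N, N⁆ with hπ
  have hyK : y ∈ K := Subgroup.mem_comap.2 (Subgroup.mem_zpowers _)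
  have hdec : ∀ g ∈ K, ∃ i : ℤ, ∃ a ∈ N, g = y ^ i * a := by
    intro g hg
    obtain ⟨i, hi⟩ := Subgroup.mem_zpowers_iff.1 (Subgroup.mem_comap.1 hg)
    refine ⟨i, (y ^ i)⁻¹ * g, ?_, by group⟩
    rw [← map_zpow] at hi
    exact QuotientGroup.eq.1 hi
  have hc' : π c ∈ ⁅K.map π, K.map π⁆ := by
    rw [← Subgroup.map_commutator]
    exact Subgroup.mem_map_of_mem _ hc
  -- The previous lemma is applied inside the group `π(K)`, so `π c` is lifted to the commutator
  -- subgroup of that group.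
  replace hc' := (Subgroup.map_subtype_commutator (K.map π)).ge hc'
  obtain ⟨c', hc', hcc⟩ := hc'
  have hnorm : (N.map π).Normal := Subgroup.Normal.map ‹_› π (QuotientGroup.mk'_surjective _)
  obtain ⟨n, hn, h⟩ := exists_eq_conj_of_mem_commutator ((N.map π).subgroupOf (K.map π))
    (by
      rintro ⟨_, _⟩ ⟨a, ha, rfl⟩ ⟨_, _⟩ ⟨b, hb, rfl⟩
      ext
      change π a * π b = π b * π a
      rw [← map_mul, ← map_mul]
      apply QuotientGroup.eq.2
      have := Subgroup.commutator_mem_commutator (N.inv_mem hb) (N.inv_mem ha)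
      rw [commutatorElement_def] at this
      convert this using 1
      group)
    ⟨π y, Subgroup.mem_map_of_mem _ hyK⟩
    (by
      rintro ⟨_, g, hg, rfl⟩
      obtain ⟨i, a, ha, rfl⟩ := hdec g hg
      have haK : a ∈ K := by
        have := K.mul_mem (K.inv_mem (K.zpow_mem hyK i)) hg
        rwa [inv_mul_cancel_left] at this
      exact ⟨i, ⟨π a, Subgroup.mem_map_of_mem _ haK⟩, Subgroup.mem_map_of_mem _ ha,
        Subtype.ext (by simp)⟩)
    hc'
  obtain ⟨n₀, hn₀, hnn⟩ := Subgroup.mem_subgroupOf.1 hn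
  refine ⟨n₀, hn₀, ?_⟩
  rw [← hcc, h]
  simp [hnn]

end Commutators

/-! ### Flows as integral 1-chains -/

namespace XDigraph

variable {X V : Type*}

/-- The signed number of passages of the edge `e` through positive edges, as a `1`-chain: a positive
edge is identified with its origin and its letter. -/
noncomputable def edgeChain (e : XEdge X V) : V × X →₀ ℤ :=
  if e.label.2 = true then Finsupp.single (e.origin, e.label.1) 1
  else -Finsupp.single (e.terminus, e.label.1) 1

/-- The `1`-chain of a path. -/
noncomputable def pathChain (p : List (XEdge X V)) : V × X →₀ ℤ :=
  (p.map edgeChain).sum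

theorem edges_of_isPathFrom {Γ : XDigraph X V} (p : List (XEdge X V)) :
    ∀ v : V, Γ.IsPathFrom v p → ∀ e ∈ p, e ∈ Γ.edges := by
  induction p with
  | nil => simp
  | cons e p ih =>
    rintro v ⟨he, -, hp⟩ e' he'
    rcases List.mem_cons.1 he' with rfl | h
    · exact he
    · exact ih _ hp _ h

/-- Folding makes an edge recoverable from its origin and label, so each step of `p` changes both
sides by the same amount. Chains, unlike flows, are finitely supported by construction, so additive
maps can be defined on them by their values on edges. -/
theorem pathFlow_eq_pathChain {Γ : XDigraph X V} (hf : Γ.IsFolded) (hi : Γ.IsInverse)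
    (p : List (XEdge X V)) (hp : ∀ e ∈ p, e ∈ Γ.edges) (e : Γ.PosEdge) :
    Γ.pathFlow p e = pathChain p (e.1.origin, e.1.label.1) := by
  classical
  induction p with
  | nil => simp [pathFlow, pathChain]
  | cons e' p ih =>
    have ih := ih fun e he => hp e (List.mem_cons_of_mem _ he)
    have he' := hp e' List.mem_cons_self
    obtain ⟨e, he, hpos⟩ := e
    have hcons : pathChain (e' :: p) = edgeChain e' + pathChain p := by simp [pathChain]
    rw [hcons, Finsupp.add_apply, ← ih]
    simp only [pathFlow, List.count_cons, edgeChain]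
    have h₁ : (e' = e) ↔ e'.label.2 = true ∧ (e'.origin, e'.label.1) = (e.origin, e.label.1) := by
      constructor
      · rintro rfl
        exact ⟨hpos, rfl⟩
      · rintro ⟨h, h'⟩
        rw [Prod.mk.injEq] at h'
        exact hf _ he' _ he h'.1 (Prod.ext h'.2 (h.trans hpos.symm))
    have h₂ : (e' = e.inv) ↔
        e'.label.2 ≠ true ∧ (e'.terminus, e'.label.1) = (e.origin, e.label.1) := by
      constructor
      · rintro rfl
        exact ⟨by simp [XEdge.inv, hpos], rfl⟩
      · rintro ⟨h, h'⟩
        rw [Prod.mk.injEq] at h'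
        have h'' : e'.inv = e := hf _ (hi _ he') _ he h'.1
          (Prod.ext h'.2 (by simp [XEdge.inv, hpos, h]))
        rw [← h'']
        simp [XEdge.inv]
    by_cases hl : e'.label.2 = true
    · by_cases ho : (e'.origin, e'.label.1) = (e.origin, e.label.1)
      · have h₃ : e' = e := h₁.2 ⟨hl, ho⟩
        have h₄ : ¬ e' = e.inv := fun h => (h₂.1 h).1 hl
        rw [if_pos hl, Finsupp.single_apply, if_pos ho, if_pos (beq_iff_eq.2 h₃),
          if_neg (by simpa using h₄)]
        push_cast
        ring
      · have h₃ : ¬ e' = e := fun h => ho (h₁.1 h).2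
        have h₄ : ¬ e' = e.inv := fun h => (h₂.1 h).1 hl
        rw [if_pos hl, Finsupp.single_apply, if_neg ho, if_neg (by simpa using h₃),
          if_neg (by simpa using h₄)]
        push_cast
        ring
    · have h₃ : ¬ e' = e := fun h => hl (h₁.1 h).1
      by_cases ho : (e'.terminus, e'.label.1) = (e.origin, e.label.1)
      · have h₄ : e' = e.inv := h₂.2 ⟨hl, ho⟩
        rw [if_neg hl, Finsupp.neg_apply, Finsupp.single_apply, if_pos ho,
          if_neg (by simpa using h₃), if_pos (beq_iff_eq.2 h₄)]
        push_cast
        ring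
      · have h₄ : ¬ e' = e.inv := fun h => ho (h₂.1 h).2
        rw [if_neg hl, Finsupp.neg_apply, Finsupp.single_apply, if_neg ho,
          if_neg (by simpa using h₃), if_neg (by simpa using h₄)]
        push_cast
        ring

theorem wordFlow_eq_iff_pathChain_eq [DecidableEq X] {Γ : XDigraph X V} (hf : Γ.IsFolded)
    (hc : Γ.IsComplete) (hi : Γ.IsInverse) {w w' : FreeGroup X} {p p' : List (XEdge X V)}
    (hp : Γ.IsTrace w.toWord p) (hp' : Γ.IsTrace w'.toWord p') :
    Γ.wordFlow w = Γ.wordFlow w' ↔ pathChain p = pathChain p' := by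
  rw [wordFlow_eq hf hp, wordFlow_eq hf hp']
  have h := pathFlow_eq_pathChain hf hi p (edges_of_isPathFrom p _ hp.1)
  have h' := pathFlow_eq_pathChain hf hi p' (edges_of_isPathFrom p' _ hp'.1)
  constructor
  · intro heq
    ext ⟨v, a⟩
    -- Completeness: every coordinate of a chain comes from an actual positive edge.
    obtain ⟨e, he, rfl, hl⟩ := hc v (a, true)
    have := congrFun heq ⟨e, he, by rw [hl]⟩
    erw [h, h'] at this
    simpa [hl] using this
  · intro heq
    ext e
    rw [h, h', heq]

end XDigraph

/-! ### Chains on the Schreier graph and the abelianization of `K` -/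

section SchreierChains

variable {X : Type*} (N : Subgroup (FreeGroup X)) [N.Normal] (H : Subgroup (FreeGroup X ⧸ N))

/-- The vertex of the Schreier graph represented by an element of the free group. -/
def schreierVertex (g : FreeGroup X) : RightCosets H :=
  rightCosetMk H (QuotientGroup.mk' N g)

theorem schreierVertex_eq_iff (g g' : FreeGroup X) :
    schreierVertex N H g = schreierVertex N H g' ↔
      g' * g⁻¹ ∈ H.comap (QuotientGroup.mk' N) := by
  rw [schreierVertex, schreierVertex, rightCosetMk_eq_iff, Subgroup.mem_comap, map_mul, map_inv]

theorem schreierVertex_surjective : Function.Surjective (schreierVertex N H) := by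
  intro v
  induction v using Quotient.inductionOn with
  | h g =>
    obtain ⟨g, rfl⟩ := QuotientGroup.mk'_surjective N g
    exact ⟨g, rfl⟩

theorem schreierVertex_mul_left {k : FreeGroup X} (hk : k ∈ H.comap (QuotientGroup.mk' N))
    (g : FreeGroup X) : schreierVertex N H (k * g) = schreierVertex N H g := by
  rw [eq_comm, schreierVertex_eq_iff, mul_inv_cancel_right]
  exact hk

/-- The edge with label `a` at the vertex represented by `g`. -/
def schreierEdge (g : FreeGroup X) (a : X × Bool) : XEdge X (RightCosets H) :=
  ⟨schreierVertex N H g, schreierVertex N H (g * FreeGroup.mk [a]), a⟩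

/-- The path with label `L` at the vertex represented by `g`. -/
def schreierPath : FreeGroup X → List (X × Bool) → List (XEdge X (RightCosets H))
  | _, [] => []
  | g, a :: L => schreierEdge N H g a :: schreierPath (g * FreeGroup.mk [a]) L

theorem isPathFrom_schreierPath (L : List (X × Bool)) : ∀ g : FreeGroup X,
    (schreierGraph N H).IsPathFrom (schreierVertex N H g) (schreierPath N H g L) ∧
      (schreierPath N H g L).map XEdge.label = L := by
  induction L with
  | nil => exact fun g => ⟨trivial, rfl⟩
  | cons a L ih =>
    intro g
    obtain ⟨h₁, h₂⟩ := ih (g * FreeGroup.mk [a])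
    refine ⟨⟨⟨QuotientGroup.mk' N g, a, ?_⟩, rfl, h₁⟩, ?_⟩
    · rfl
    · rw [schreierPath, List.map_cons, h₂]
      rfl

/-- The chain of the path with label `L` at the vertex represented by `g`. -/
noncomputable def listChain (g : FreeGroup X) (L : List (X × Bool)) :
    RightCosets H × X →₀ ℤ :=
  XDigraph.pathChain (schreierPath N H g L)

theorem listChain_nil (g : FreeGroup X) : listChain N H g [] = 0 := rfl

theorem listChain_cons (g : FreeGroup X) (a : X × Bool) (L : List (X × Bool)) :
    listChain N H g (a :: L) =
      XDigraph.edgeChain (schreierEdge N H g a) + listChain N H (g * FreeGroup.mk [a]) L := by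
  simp [listChain, XDigraph.pathChain, schreierPath]

theorem listChain_append (L₁ L₂ : List (X × Bool)) : ∀ g : FreeGroup X,
    listChain N H g (L₁ ++ L₂) =
      listChain N H g L₁ + listChain N H (g * FreeGroup.mk L₁) L₂ := by
  induction L₁ with
  | nil =>
    intro g
    rw [List.nil_append, listChain_nil, zero_add, ← FreeGroup.one_eq_mk, mul_one]
  | cons a L ih =>
    intro g
    rw [List.cons_append, listChain_cons, listChain_cons, ih, mul_assoc, FreeGroup.mul_mk,
      add_assoc]
    rfl

theorem mk_singleton_mul_mk_singleton_not (x : X) (b : Bool) :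
    (FreeGroup.mk [(x, b)] * FreeGroup.mk [(x, !b)] : FreeGroup X) = 1 := by
  have h : (FreeGroup.mk [(x, !b)] : FreeGroup X) = (FreeGroup.mk [(x, b)])⁻¹ := by
    simp [FreeGroup.inv_mk, FreeGroup.invRev]
  rw [h, mul_inv_cancel]

/-- A cancelling pair traverses an edge and returns at once, contributing zero; so the chain depends
only on the group element. -/
theorem listChain_eq_of_step {L L' : List (X × Bool)} (h : FreeGroup.Red.Step L L')
    (g : FreeGroup X) : listChain N H g L = listChain N H g L' := by
  cases h with
  | @not L₁ L₂ x b =>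
    rw [listChain_append, listChain_append, listChain_cons, listChain_cons, mul_assoc (g * _),
      mk_singleton_mul_mk_singleton_not, mul_one, ← add_assoc (XDigraph.edgeChain _)]
    have : XDigraph.edgeChain (schreierEdge N H (g * FreeGroup.mk L₁) (x, b)) +
        XDigraph.edgeChain (schreierEdge N H (g * FreeGroup.mk L₁ * FreeGroup.mk [(x, b)])
          (x, !b)) = 0 := by
      have hb := mk_singleton_mul_mk_singleton_not x b
      rw [schreierEdge, schreierEdge, mul_assoc _ (FreeGroup.mk [(x, b)]), hb, mul_one]
      cases b <;> simp [XDigraph.edgeChain]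
    rw [this, zero_add]

theorem listChain_mul_left {k : FreeGroup X} (hk : k ∈ H.comap (QuotientGroup.mk' N))
    (L : List (X × Bool)) : ∀ g : FreeGroup X, listChain N H (k * g) L = listChain N H g L := by
  induction L with
  | nil => exact fun _ => rfl
  | cons a L ih =>
    intro g
    rw [listChain_cons, listChain_cons, mul_assoc, ih, schreierEdge, schreierEdge, mul_assoc,
      schreierVertex_mul_left N H hk, schreierVertex_mul_left N H hk]

/-- A function on the free group whose increments along edges depend only on the edges of the
Schreier graph is integrated by an additive map on chains. -/
theorem exists_addMonoidHom_listChain {A : Type*} [AddCommGroup A] (f : FreeGroup X → A)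
    (hf : ∀ k ∈ H.comap (QuotientGroup.mk' N), ∀ g u : FreeGroup X,
      f (k * g * u) - f (k * g) = f (g * u) - f g) :
    ∃ Ψ : (RightCosets H × X →₀ ℤ) →+ A, ∀ (L : List (X × Bool)) (g : FreeGroup X),
      Ψ (listChain N H g L) = f (g * FreeGroup.mk L) - f g := by
  -- An edge gets the increment of `f` along a chosen lift; `hf` makes this independent of the lift.
  obtain ⟨s, hs⟩ := (schreierVertex_surjective N H).hasRightInverse
  let φ : RightCosets H × X → A :=
    fun e => f (s e.1 * FreeGroup.mk [(e.2, true)]) - f (s e.1)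
  have hφ : ∀ (g : FreeGroup X) (x : X),
      φ (schreierVertex N H g, x) = f (g * FreeGroup.mk [(x, true)]) - f g := by
    intro g x
    have hg := (schreierVertex_eq_iff N H _ _).1 (hs (schreierVertex N H g))
    have := hf _ hg (s (schreierVertex N H g)) (FreeGroup.mk [(x, true)])
    rw [inv_mul_cancel_right] at this
    exact this.symm
  refine ⟨Finsupp.liftAddHom fun e => (zmultiplesHom A) (φ e), ?_⟩
  have hedge : ∀ (g : FreeGroup X) (a : X × Bool),
      (Finsupp.liftAddHom fun e => (zmultiplesHom A) (φ e))
        (XDigraph.edgeChain (schreierEdge N H g a)) = f (g * FreeGroup.mk [a]) - f g := by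
    rintro g ⟨x, b⟩
    cases b
    · have h := mk_singleton_mul_mk_singleton_not x false
      simp only [Bool.not_false] at h
      rw [schreierEdge, XDigraph.edgeChain, if_neg (by simp), map_neg,
        Finsupp.liftAddHom_apply_single, zmultiplesHom_apply, one_zsmul, hφ, mul_assoc, h, mul_one,
        neg_sub]
    · simp [XDigraph.edgeChain, schreierEdge, hφ]
  intro L
  induction L with
  | nil =>
    intro g
    rw [listChain_nil, map_zero, ← FreeGroup.one_eq_mk, mul_one, sub_self]
  | cons a L ih =>
    intro g
    rw [listChain_cons, map_add, ih, hedge, mul_assoc, FreeGroup.mul_mk, List.singleton_append]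
    abel

variable [DecidableEq X]

theorem listChain_toWord_mk (L : List (X × Bool)) (g : FreeGroup X) :
    listChain N H g (FreeGroup.mk L).toWord = listChain N H g L := by
  rw [FreeGroup.toWord_mk]
  have h : FreeGroup.Red L (FreeGroup.reduce L) := FreeGroup.reduce.red
  generalize FreeGroup.reduce L = L' at h
  induction h with
  | refl => rfl
  | tail _ h ih => rw [← listChain_eq_of_step N H h, ih]

/-- The chain of the path labelled by `w` at the vertex represented by `g`. -/
noncomputable def wordChain (g w : FreeGroup X) : RightCosets H × X →₀ ℤ :=
  listChain N H g w.toWord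

theorem wordChain_mul (g u v : FreeGroup X) :
    wordChain N H g (u * v) = wordChain N H g u + wordChain N H (g * u) v := by
  have h : u * v = FreeGroup.mk (u.toWord ++ v.toWord) := by
    rw [← FreeGroup.mul_mk, FreeGroup.mk_toWord, FreeGroup.mk_toWord]
  rw [wordChain, h, listChain_toWord_mk, listChain_append, FreeGroup.mk_toWord]
  rfl

theorem wordFlow_schreierGraph_eq_iff (w w' : FreeGroup X) :
    (schreierGraph N H).wordFlow w = (schreierGraph N H).wordFlow w' ↔
      wordChain N H 1 w = wordChain N H 1 w' :=
  XDigraph.wordFlow_eq_iff_pathChain_eq (schreierGraph_isFolded N H)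
    (schreierGraph_isComplete N H) (schreierGraph_isInverse N H)
    (isPathFrom_schreierPath N H w.toWord 1) (isPathFrom_schreierPath N H w'.toWord 1)

/-- The chain of a closed path at the root, as a homomorphism. -/
noncomputable def loopChain :
    H.comap (QuotientGroup.mk' N) →* Multiplicative (RightCosets H × X →₀ ℤ) where
  toFun k := Multiplicative.ofAdd (wordChain N H 1 k)
  map_one' := by simp [wordChain, listChain_nil]
  map_mul' := by
    rintro ⟨k, hk⟩ ⟨k', hk'⟩
    -- The loop labelled `k` returns to the root, so the second factor is read from the root again.
    have h := listChain_mul_left N H hk k'.toWord 1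
    rw [← ofAdd_add]
    congr 1
    change wordChain N H 1 (k * k') = _
    rw [wordChain_mul, one_mul]
    congr 1
    rw [mul_one] at h
    exact h

/-- Elements of `K` that are congruent modulo `[K, K]` have the same chain. -/
theorem wordChain_eq_of_mem_commutator {w w' : FreeGroup X}
    (hw' : w' ∈ H.comap (QuotientGroup.mk' N))
    (h : w * w'⁻¹ ∈ ⁅H.comap (QuotientGroup.mk' N), H.comap (QuotientGroup.mk' N)⁆) :
    wordChain N H 1 w = wordChain N H 1 w' := by
  rw [← Subgroup.map_subtype_commutator] at h
  obtain ⟨c, hc, hcw⟩ := h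
  have h1 : loopChain N H c = 1 := Abelianization.commutator_subset_ker (loopChain N H) hc
  have h2 : w = (c * ⟨w', hw'⟩ : H.comap (QuotientGroup.mk' N)) := by
    simp only [Subgroup.coe_mul]
    change _ = (H.comap (QuotientGroup.mk' N)).subtype c * w'
    rw [hcw, inv_mul_cancel_right]
  have h3 := map_mul (loopChain N H) c ⟨w', hw'⟩
  rw [h1, one_mul] at h3
  rw [h2]
  exact Multiplicative.ofAdd.injective h3

/-- Paths from the root with the same chain have the same terminus. -/
theorem schreierVertex_eq_of_wordChain_eq {w w' : FreeGroup X}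
    (h : wordChain N H 1 w = wordChain N H 1 w') :
    schreierVertex N H w = schreierVertex N H w' := by
  -- For this `f`, `Ψ` is the boundary map: a path goes to its terminus minus its origin.
  obtain ⟨Ψ, hΨ⟩ := exists_addMonoidHom_listChain N H
    (fun g => (Finsupp.single (schreierVertex N H g) 1 : RightCosets H →₀ ℤ))
    (by
      intro k hk g u
      simp only [mul_assoc, schreierVertex_mul_left N H hk])
  have h' := congrArg Ψ h
  rw [wordChain, wordChain, hΨ, hΨ, FreeGroup.mk_toWord, FreeGroup.mk_toWord, one_mul, one_mul,
    sub_left_inj] at h'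
  exact Finsupp.single_left_injective one_ne_zero h'

/-- Elements of `K` with the same chain are congruent modulo `[K, K]`. -/
theorem mem_commutator_of_wordChain_eq {w w' : FreeGroup X}
    (hw : w ∈ H.comap (QuotientGroup.mk' N)) (hw' : w' ∈ H.comap (QuotientGroup.mk' N))
    (h : wordChain N H 1 w = wordChain N H 1 w') :
    w * w'⁻¹ ∈ ⁅H.comap (QuotientGroup.mk' N), H.comap (QuotientGroup.mk' N)⁆ := by
  obtain ⟨s, hs⟩ := (schreierVertex_surjective N H).hasRightInverse
  have hmem : ∀ g : FreeGroup X,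
      g * (s (schreierVertex N H g))⁻¹ ∈ H.comap (QuotientGroup.mk' N) :=
    fun g => (schreierVertex_eq_iff N H _ _).1 (hs (schreierVertex N H g))
  -- `τ` records the `K`-part of `g` relative to the transversal `s`. It is `K`-equivariant up to
  -- translation (`hτ`), so its increments descend to edges and `Ψ` recovers the class of a loop in
  -- the abelianization.
  let τ : FreeGroup X → Additive (Abelianization (H.comap (QuotientGroup.mk' N))) :=
    fun g => Additive.ofMul (Abelianization.of ⟨_, hmem g⟩)
  have hτ : ∀ (k : FreeGroup X) (hk : k ∈ H.comap (QuotientGroup.mk' N)) (g : FreeGroup X),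
      τ (k * g) = Additive.ofMul (Abelianization.of ⟨k, hk⟩) + τ g := by
    intro k hk g
    rw [← ofMul_mul, ← map_mul]
    simp only [τ, schreierVertex_mul_left N H hk, MulMemClass.mk_mul_mk, mul_assoc]
  obtain ⟨Ψ, hΨ⟩ := exists_addMonoidHom_listChain N H τ
    (by
      intro k hk g u
      rw [mul_assoc, hτ k hk, hτ k hk, add_sub_add_left_eq_sub])
  have h' := congrArg Ψ h
  -- The representative of the root need not be `1`, so `τ 1` may be nonzero; it cancels from both
  -- sides.
  rw [wordChain, wordChain, hΨ, hΨ, FreeGroup.mk_toWord, FreeGroup.mk_toWord, one_mul, one_mul,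
    sub_left_inj, ← mul_one w, ← mul_one w', hτ w hw, hτ w' hw', add_left_inj] at h'
  have h'' : Abelianization.of (⟨w, hw⟩ * ⟨w', hw'⟩⁻¹ : H.comap (QuotientGroup.mk' N)) = 1 := by
    rw [map_mul, map_inv, mul_inv_eq_one]
    exact Additive.ofMul.injective h'
  rw [← Subgroup.map_subtype_commutator]
  refine ⟨⟨w, hw⟩ * ⟨w', hw'⟩⁻¹, ?_, rfl⟩
  rw [SetLike.mem_coe, ← Abelianization.ker_of]
  exact h''

end SchreierChains

/-! ### Conjugacy modulo `[N,N]` -/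

section Conjugacy

variable {X : Type*} (N : Subgroup (FreeGroup X)) [N.Normal]

theorem le_comap_mk' (H : Subgroup (FreeGroup X ⧸ N)) : N ≤ H.comap (QuotientGroup.mk' N) := by
  intro n hn
  rw [Subgroup.mem_comap, QuotientGroup.mk'_apply, (QuotientGroup.eq_one_iff n).2 hn]
  exact H.one_mem

variable [DecidableEq X]

/-- The flow of `w` equals the flow of an element `y` of `K` if and only if `w ≡ y` modulo
`[K, K]`. -/
theorem wordFlow_eq_iff_mem_commutator (H : Subgroup (FreeGroup X ⧸ N)) {y : FreeGroup X}
    (hy : y ∈ H.comap (QuotientGroup.mk' N)) (w : FreeGroup X) :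
    (schreierGraph N H).wordFlow w = (schreierGraph N H).wordFlow y ↔
      w * y⁻¹ ∈ ⁅H.comap (QuotientGroup.mk' N), H.comap (QuotientGroup.mk' N)⁆ := by
  rw [wordFlow_schreierGraph_eq_iff]
  refine ⟨fun h => ?_, wordChain_eq_of_mem_commutator N H hy⟩
  -- Equal flows force a common terminus; since `y ∈ K`, this puts `w` in `K`.
  have hw := (schreierVertex_eq_iff N H _ _).1 (schreierVertex_eq_of_wordChain_eq N H h.symm)
  refine mem_commutator_of_wordChain_eq N H ?_ hy h
  simpa using Subgroup.mul_mem _ hw hy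

theorem isConj_iff_exists_wordFlow_eq (x y : FreeGroup X) :
    IsConj (QuotientGroup.mk' ⁅N, N⁆ x) (QuotientGroup.mk' ⁅N, N⁆ y) ↔
      ∃ z : FreeGroup X,
        (schreierGraph N (Subgroup.zpowers (QuotientGroup.mk' N y))).wordFlow (z * x * z⁻¹) =
          (schreierGraph N (Subgroup.zpowers (QuotientGroup.mk' N y))).wordFlow y := by
  have hy : y ∈ (Subgroup.zpowers (QuotientGroup.mk' N y)).comap (QuotientGroup.mk' N) :=
    Subgroup.mem_comap.2 (Subgroup.mem_zpowers _)
  simp_rw [wordFlow_eq_iff_mem_commutator N _ hy]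
  rw [isConj_iff]
  constructor
  · rintro ⟨c, hc⟩
    obtain ⟨z, rfl⟩ := QuotientGroup.mk'_surjective _ c
    refine ⟨z, Subgroup.commutator_mono (le_comap_mk' N _) (le_comap_mk' N _) ?_⟩
    rw [← QuotientGroup.eq_one_iff, ← QuotientGroup.mk'_apply, map_mul, map_mul, map_mul, map_inv,
      map_inv, hc, mul_inv_cancel]
  · rintro ⟨z, hz⟩
    obtain ⟨n, -, h⟩ := exists_conj_of_mem_commutator_comap_zpowers N y hz
    -- From `z x z⁻¹ ≡ n y n⁻¹`, conjugating by `n⁻¹` leaves `y`.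
    refine ⟨QuotientGroup.mk' _ (n⁻¹ * z), ?_⟩
    simp only [map_mul, map_inv, mul_inv_rev, mul_left_inj, inv_inv] at h ⊢
    calc _ = (QuotientGroup.mk' ⁅N, N⁆ n)⁻¹ * (QuotientGroup.mk' ⁅N, N⁆ z *
            QuotientGroup.mk' ⁅N, N⁆ x * (QuotientGroup.mk' ⁅N, N⁆ z)⁻¹) *
            QuotientGroup.mk' ⁅N, N⁆ n := by group
      _ = _ := by rw [h]; group

/-- With `w = z x z⁻¹` and `m = z' z⁻¹`, both in `K`, one has `z' x z'⁻¹ = [m, w] w`, so the change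
of conjugator is absorbed by `[K,K]`. -/
theorem wordFlow_conj_eq_of_mk'_eq (H : Subgroup (FreeGroup X ⧸ N)) {x y z z' : FreeGroup X}
    (hy : y ∈ H.comap (QuotientGroup.mk' N)) (hz : QuotientGroup.mk' N z = QuotientGroup.mk' N z')
    (h : (schreierGraph N H).wordFlow (z * x * z⁻¹) = (schreierGraph N H).wordFlow y) :
    (schreierGraph N H).wordFlow (z' * x * z'⁻¹) = (schreierGraph N H).wordFlow y := by
  rw [wordFlow_eq_iff_mem_commutator N H hy] at h ⊢
  have hn : z' * z⁻¹ ∈ H.comap (QuotientGroup.mk' N) := by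
    rw [Subgroup.mem_comap, map_mul, map_inv, hz, mul_inv_cancel]
    exact H.one_mem
  have hw : z * x * z⁻¹ ∈ H.comap (QuotientGroup.mk' N) := by
    have := Subgroup.mul_mem _ (Subgroup.commutator_le_self _ h) hy
    rwa [inv_mul_cancel_right] at this
  have := Subgroup.mul_mem _ (Subgroup.commutator_mem_commutator hn hw) h
  rw [commutatorElement_def] at this
  convert this using 1
  group

end Conjugacy

theorem mainTheorem5 (r d : ℕ) (hd : 1 ≤ d) (x y : FreeGroup (Fin r)) :
    (IsConj (toFreeSolvable r d x) (toFreeSolvable r d y) ↔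
      ∃ z : FreeGroup (Fin r),
        (schreierOf r (d - 1) y).wordFlow (z * x * z⁻¹) = (schreierOf r (d - 1) y).wordFlow y) ∧
    (∀ z z' : FreeGroup (Fin r), toFreeSolvable r (d - 1) z = toFreeSolvable r (d - 1) z' →
      ((schreierOf r (d - 1) y).wordFlow (z * x * z⁻¹) = (schreierOf r (d - 1) y).wordFlow y ↔
        (schreierOf r (d - 1) y).wordFlow (z' * x * z'⁻¹) =
          (schreierOf r (d - 1) y).wordFlow y)) := by
  obtain ⟨k, rfl⟩ : ∃ k, d = k + 1 := ⟨d - 1, by omega⟩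
  -- Definitionally, the derived series at `k + 1` is `[N,N]` for `N` its term at `k`.
  refine ⟨isConj_iff_exists_wordFlow_eq (derivedSeries (FreeGroup (Fin r)) k) x y, ?_⟩
  have hy : y ∈ (Subgroup.zpowers (toFreeSolvable r k y)).comap (toFreeSolvable r k) :=
    Subgroup.mem_comap.2 (Subgroup.mem_zpowers _)
  exact fun z z' h => ⟨wordFlow_conj_eq_of_mk'_eq _ _ hy h,
    wordFlow_conj_eq_of_mk'_eq _ _ hy h.symm⟩
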